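/- **Conventions.** Let $[n]=\{0,1,\dots,n\}$, pointed by $0$, and let $\Gamma^{op}$ be the category of the pointed sets $[n]$ ($n\ge 0$) and pointed maps. Identify $[n]\wedge[m]$ with $[nm]$ by the inverse lexicographical order, $i\wedge j\mapsto i+n(j-1)$. A discrete $\Gamma$-ring $R$ is a functor from $\Gamma^{op}$ to pointed sets with $R[0]$ a point, together with a unit $\eta:[n]\to R[n]$ and a multiplication $R[n]\wedge R[m]\to R([n]\wedge[m])=R[nm]$, both natural maps of pointed sets, satisfying the associativity and unit conditions; write $1=\eta(1)\in R[1]$, and write $f$ for the map $R[n]\to R[m]$ induced by a pointed map $f:[n]\to[m]$. The powers of $r\in R[2]$ are elements $r^k\in R[2^k]$, with $r^0=1$. A multiplicative map of discrete $\Gamma$-rings is a natural transformation of functors to pointed sets that preserves units and products. The $\Gamma$-ring $H\mathbf Z$ sends $[n]$ to the reduced free abelian group $\tilde{\mathbf Z}[n]=\mathbf Z^n$, with unit the inclusion of generators and multiplication $(\sum a_kk)\wedge(\sum b_ll)\mapsto\sum a_kb_l(k\wedge l)$. Let $p^n_i:[n]\to[n-1]$ send $i$ to $0$, fix each $j<i$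 and send each $j>i$ to $j-1$. Let $d^n_j:[n-1]\to[n]$ be the order-preserving injection missing $j\ge 1$. For $1\le i<j\le n$ and $1\le k\le n-1$ let $s^n_{i,j,k}:[n]\to[n-1]$ send $i$ and $j$ to $k$ and map the other elements bijectively onto $[n-1]\setminus\{k\}$, preserving the order. Write $\{1,\dots,2^k\}=A_+\sqcup A_-$, where $i\in A_+$ if and only if the binary expansion of $i-1$ has an even number of digits $1$. A *formal difference law* in $R$ is an element $r\in R[2]$ such that 1. $p^2_2(r)=1$ and $s^2_{1,2,1}(r)=0$; 2. $p^2_1(r)\,r=r\,p^2_1(r)=\sigma(r)$ in $R[2]$, where $\sigma$ exchanges $1$ and $2$; 3. for every $k$, $r^k\in R[2^k]$ is fixed by all permutations of $\{1,\dots,2^k\}$ that preserve $A_+$ and $A_-$; 4. $s^{2^k}_{i,j,l}(r^k)=d^{2^k-1}_l\,p^{2^k-1}_i\,p^{2^k}_j(r^k)$ for all $k$, all $1\le i<j\le 2^k$ of which one lies in $A_+$ and the other in $A_-$, and all $1\le l\le 2^k-1$. **Theorem.** Let $R$ be a discrete $\Gamma$-ring. For every formal difference law $r\in R[2]$ there is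 a unique multiplicative map $\phi:H\mathbf Z\to R$ such that $\phi((1,-1)^n)=r^n$ in $R[2^n]$ for all $n\ge 0$, where $(1,-1)\in H\mathbf Z[2]$. Conversely, every multiplicative map $\phi:H\mathbf Z\to R$ determines a formal difference law $r=\phi(1,-1)\in R[2]$. These two assignments are mutually inverse, so the set of formal difference laws in $R$ is in bijection with the set of multiplicative maps $H\mathbf Z\to R$, naturally in $R$ with respect to multiplicative maps $R\to R'$. -/

import Mathlib

universe u v w

/-! ### The category `Γᵒᵖ`: pointed sets `[n] = {0, 1, …, n}` and pointed maps -/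

/-- A pointed map `[n] → [m]`, where `[n] = {0, 1, …, n} = Fin (n + 1)` has base point `0`. -/
@[ext]
structure PtMap (n m : ℕ) where
  toFun : Fin (n + 1) → Fin (m + 1)
  map_zero : toFun 0 = 0

namespace PtMap

instance (n m : ℕ) : CoeFun (PtMap n m) (fun _ => Fin (n + 1) → Fin (m + 1)) := ⟨PtMap.toFun⟩

/-- The identity of `[n]`. -/
def id (n : ℕ) : PtMap n n := ⟨fun a => a, rfl⟩

/-- The composite `g ∘ f`. -/
def comp {n m k : ℕ} (g : PtMap m k) (f : PtMap n m) : PtMap n k :=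
  ⟨fun a => g (f a), by rw [f.map_zero, g.map_zero]⟩

/-- The identification `[a] = [b]` for equal numbers `a = b`. -/
def cast {a b : ℕ} (h : a = b) : PtMap a b :=
  ⟨Fin.cast (by rw [h]), by ext; simp⟩

/-- The action of a permutation of `{1, …, n}` on `[n]`. The element `i : Fin n` stands for the
element `i + 1` of `{1, …, n}`. -/
def perm {n : ℕ} (e : Equiv.Perm (Fin n)) : PtMap n n :=
  ⟨fun a => Fin.cases 0 (fun i => (e i).succ) a, rfl⟩

/-- The `i`-th restriction `p_i^n : [n] → [n-1]`, for `1 ≤ i ≤ n`: `j ↦ j` for `j < i`,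
`i ↦ 0`, and `j ↦ j - 1` for `j > i`. -/
def p (n i : ℕ) (_h1 : 1 ≤ i) (_h2 : i ≤ n) : PtMap n (n - 1) where
  toFun a :=
    if h : a.val < i then ⟨a.val, by omega⟩
    else if a.val = i then 0
    else ⟨a.val - 1, by have := a.isLt; omega⟩
  map_zero := by
    have h : ((0 : Fin (n + 1)).val) < i := by simp; omega
    rw [dif_pos h]; rfl

/-- The order preserving injection `d_j^n : [n-1] → [n]` that misses `j`, for `1 ≤ j ≤ n`. -/
def d (n j : ℕ) (_h1 : 1 ≤ j) (_h2 : j ≤ n) : PtMap (n - 1) n where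
  toFun a :=
    if a.val < j then ⟨a.val, by have := a.isLt; omega⟩
    else ⟨a.val + 1, by have := a.isLt; omega⟩
  map_zero := by
    have h : ((0 : Fin (n - 1 + 1)).val) < j := by simp; omega
    rw [if_pos h]; rfl

/-- The summing map `s_{i,j,k}^n : [n] → [n-1]`, for `1 ≤ i < j ≤ n` and `1 ≤ k ≤ n - 1`: it sends
`i` and `j` to `k` and the other elements of `[n]` bijectively onto `[n-1] \ {k}`, preserving the
order. The order preserving bijection removes `j` and `i` and then leaves a gap at `k`. -/
def s (n i j k : ℕ) (hi : 1 ≤ i) (hij : i < j) (hj : j ≤ n) (hk : 1 ≤ k) (hkn : k ≤ n - 1) :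
    PtMap n (n - 1) where
  toFun a :=
    if a.val = i ∨ a.val = j then ⟨k, by omega⟩
    else d (n - 1) k hk hkn (p (n - 1) i hi (by omega) (p n j (by omega) hj a))
  map_zero := by
    have h : ¬ (((0 : Fin (n + 1)).val) = i ∨ ((0 : Fin (n + 1)).val) = j) := by simp; omega
    rw [if_neg h, map_zero, map_zero, map_zero]

end PtMap

/-! ### Smash products of pointed sets

`[n] ∧ [m]` is identified with `[nm]` by the inverse lexicographical order: the element `i ∧ j`
with `1 ≤ i ≤ n`, `1 ≤ j ≤ m` is the element `i + n (j - 1)` of `[nm]`. -/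

/-- The identification of `{1, …, n} × {1, …, m}` with `{1, …, nm}`. With indices
starting from zero it is `(i, j) ↦ i + n j`. -/
def colex (n m : ℕ) : Fin n × Fin m ≃ Fin (n * m) :=
  ((Equiv.prodComm _ _).trans finProdFinEquiv).trans (finCongr (Nat.mul_comm m n))

theorem colex_val {n m : ℕ} (i : Fin n) (j : Fin m) : (colex n m (i, j)).val = i + n * j := by
  simp [colex]

/-- The element `i ∧ j` of `[n] ∧ [m] = [nm]`; it is the base point if `i = 0` or `j = 0`. -/
def smashPt {n m : ℕ} (i : Fin (n + 1)) (j : Fin (m + 1)) : Fin (n * m + 1) :=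
  Fin.cases 0 (fun i' => Fin.cases 0 (fun j' => (colex n m (i', j')).succ) j) i

theorem smashPt_zero_left {n m : ℕ} (j : Fin (m + 1)) :
    smashPt (0 : Fin (n + 1)) j = 0 := rfl

theorem smashPt_zero_right {n m : ℕ} (i : Fin (n + 1)) :
    smashPt i (0 : Fin (m + 1)) = 0 := by
  cases i using Fin.cases <;> rfl

theorem smashPt_succ {n m : ℕ} (i : Fin n) (j : Fin m) :
    smashPt i.succ j.succ = (colex n m (i, j)).succ := rfl

theorem smashPt_eq_succ {n m : ℕ} (a : Fin (n + 1)) (b : Fin (m + 1)) (i : Fin n) (j : Fin m) :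
    smashPt a b = (colex n m (i, j)).succ ↔ a = i.succ ∧ b = j.succ := by
  cases a using Fin.cases with
  | zero => simp [smashPt_zero_left, (Fin.succ_ne_zero _).symm]
  | succ a =>
    cases b using Fin.cases with
    | zero => simp [smashPt_zero_right, (Fin.succ_ne_zero _).symm]
    | succ b => simp [smashPt_succ]

namespace PtMap

/-- The smash product `f ∧ g : [n] ∧ [m] → [n'] ∧ [m']` of pointed maps,
`i ∧ j ↦ f i ∧ g j`. -/
def smash {n n' m m' : ℕ} (f : PtMap n n') (g : PtMap m m') : PtMap (n * m) (n' * m') where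
  toFun c := Fin.cases 0
    (fun c' => smashPt (f ((colex n m).symm c').1.succ) (g ((colex n m).symm c').2.succ)) c
  map_zero := rfl

theorem smash_apply {n n' m m' : ℕ} (f : PtMap n n') (g : PtMap m m')
    (i : Fin (n + 1)) (j : Fin (m + 1)) :
    smash f g (smashPt i j) = smashPt (f i) (g j) := by
  cases i using Fin.cases with
  | zero => simp [smashPt_zero_left, map_zero]
  | succ i =>
    cases j using Fin.cases with
    | zero => simp [smashPt_zero_right, map_zero]
    | succ j => simp [smashPt_succ, smash]

/-- The pointed map `[m] → [n] ∧ [m]`, `j ↦ a ∧ j`. -/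
def smashLeft {n : ℕ} (a : Fin (n + 1)) (m : ℕ) : PtMap m (n * m) :=
  ⟨fun j => smashPt a j, smashPt_zero_right a⟩

/-- The pointed map `[n] → [n] ∧ [m]`, `i ↦ i ∧ b`. -/
def smashRight (n : ℕ) {m : ℕ} (b : Fin (m + 1)) : PtMap n (n * m) :=
  ⟨fun i => smashPt i b, smashPt_zero_left b⟩

/-- Under the inverse lexicographical order, the associativity isomorphism
`([n] ∧ [m]) ∧ [k] ≅ [n] ∧ ([m] ∧ [k])` is the identity of `[nmk]`. -/
theorem cast_assoc {n m k : ℕ} (a : Fin (n + 1)) (b : Fin (m + 1)) (c : Fin (k + 1)) :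
    cast (Nat.mul_assoc n m k) (smashPt (smashPt a b) c) = smashPt a (smashPt b c) := by
  cases a using Fin.cases with
  | zero => simp [smashPt_zero_left, map_zero]
  | succ a =>
    cases b using Fin.cases with
    | zero => simp [smashPt_zero_left, smashPt_zero_right, map_zero]
    | succ b =>
      cases c using Fin.cases with
      | zero => simp [smashPt_zero_right, map_zero]
      | succ c =>
        ext
        simp only [smashPt_succ, cast, Fin.val_cast, Fin.val_succ, colex_val]
        ring

end PtMap

/-! ### Discrete `Γ`-spaces and discrete `Γ`-rings -/

/-- A discrete `Γ`-space: a functor `F` from `Γᵒᵖ` to pointed sets with `F[0] = [0]`. -/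
structure DiscreteGammaSpace where
  obj : ℕ → Type u
  zero : ∀ n, obj n
  map : ∀ {n m : ℕ}, PtMap n m → obj n → obj m
  map_pt : ∀ {n m : ℕ} (f : PtMap n m), map f (zero n) = zero m
  map_id : ∀ {n : ℕ} (x : obj n), map (PtMap.id n) x = x
  map_comp : ∀ {n m k : ℕ} (g : PtMap m k) (f : PtMap n m) (x : obj n),
    map (g.comp f) x = map g (map f x)
  eq_zero : ∀ x : obj 0, x = zero 0

/-- A discrete `Γ`-ring: a discrete `Γ`-space `R` with a unit `η : S → R`, where `S` is the identity
functor, and a multiplication `μ : R ∧ R → R`, which are associative and unital. By the universal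
property of the smash product of `Γ`-spaces, `μ` is a family of maps
`R[n] ∧ R[m] → R([n] ∧ [m])` of pointed sets that is natural in `[n]` and `[m]`. In these terms the
unit isomorphism `S ∧ R ≅ R` is given by `[n] ∧ R[m] → R([n] ∧ [m])`,
`a ∧ x ↦ R(j ↦ a ∧ j)(x)`, and similarly on the other side. -/
structure DiscreteGammaRing extends DiscreteGammaSpace.{u} where
  eta : ∀ n : ℕ, Fin (n + 1) → obj n
  eta_zero : ∀ n, eta n 0 = zero n
  eta_map : ∀ {n m : ℕ} (f : PtMap n m) (a : Fin (n + 1)), map f (eta n a) = eta m (f a)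
  mul : ∀ {n m : ℕ}, obj n → obj m → obj (n * m)
  zero_mul : ∀ {n m : ℕ} (y : obj m), mul (zero n) y = zero (n * m)
  mul_zero : ∀ {n m : ℕ} (x : obj n), mul x (zero m) = zero (n * m)
  mul_map : ∀ {n n' m m' : ℕ} (f : PtMap n n') (g : PtMap m m') (x : obj n) (y : obj m),
    map (f.smash g) (mul x y) = mul (map f x) (map g y)
  mul_assoc : ∀ {n m k : ℕ} (x : obj n) (y : obj m) (z : obj k),
    map (PtMap.cast (Nat.mul_assoc n m k)) (mul (mul x y) z) = mul x (mul y z)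
  eta_mul : ∀ {n m : ℕ} (a : Fin (n + 1)) (x : obj m),
    mul (eta n a) x = map (PtMap.smashLeft a m) x
  mul_eta : ∀ {n m : ℕ} (x : obj n) (b : Fin (m + 1)),
    mul x (eta m b) = map (PtMap.smashRight n b) x

namespace DiscreteGammaRing

/-- The unit `1 = η(1) ∈ R[1]`. -/
def one (R : DiscreteGammaRing.{u}) : R.obj 1 := R.eta 1 1

/-- The powers `x^k ∈ R[n^k]` of an element `x ∈ R[n]`, with `x^0 = 1 ∈ R[1]`. -/
def pow (R : DiscreteGammaRing.{u}) {n : ℕ} (x : R.obj n) : ∀ k : ℕ, R.obj (n ^ k)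
  | 0 => R.one
  | k + 1 => R.mul (pow R x k) x

end DiscreteGammaRing

/-- A multiplicative map `R → R'` of discrete `Γ`-rings: a natural transformation of functors to
pointed sets that is compatible with the units and the multiplications. -/
@[ext]
structure MultMap (R : DiscreteGammaRing.{u}) (R' : DiscreteGammaRing.{v}) where
  app : ∀ n : ℕ, R.obj n → R'.obj n
  app_zero : ∀ n, app n (R.zero n) = R'.zero n
  naturality : ∀ {n m : ℕ} (f : PtMap n m) (x : R.obj n), app m (R.map f x) = R'.map f (app n x)
  app_eta : ∀ (n : ℕ) (a : Fin (n + 1)), app n (R.eta n a) = R'.eta n a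
  app_mul : ∀ {n m : ℕ} (x : R.obj n) (y : R.obj m),
    app (n * m) (R.mul x y) = R'.mul (app n x) (app m y)

/-- The composite `ψ ∘ φ` of multiplicative maps. -/
def MultMap.comp {R : DiscreteGammaRing.{u}} {R' : DiscreteGammaRing.{v}}
    {R'' : DiscreteGammaRing.{w}} (ψ : MultMap R' R'') (φ : MultMap R R') : MultMap R R'' where
  app n x := ψ.app n (φ.app n x)
  app_zero n := by rw [φ.app_zero, ψ.app_zero]
  naturality f x := by rw [φ.naturality, ψ.naturality]
  app_eta n a := by rw [φ.app_eta, ψ.app_eta]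
  app_mul x y := by rw [φ.app_mul, ψ.app_mul]

/-! ### The `Γ`-ring `HZ` -/

namespace HZ

/-- Functoriality of the reduced free abelian group: the coefficient at `j` of the image of
`∑ v_i i` under `f` is the sum of the `v_i` with `f i = j`. -/
def map {n m : ℕ} (f : PtMap n m) (v : Fin n → ℤ) : Fin m → ℤ :=
  fun j => ∑ i : Fin n, if f i.succ = j.succ then v i else 0

/-- The multiplication `(∑ v_k k) ∧ (∑ w_l l) ↦ ∑ v_k w_l (k ∧ l)`. -/
def mul {n m : ℕ} (v : Fin n → ℤ) (w : Fin m → ℤ) : Fin (n * m) → ℤ :=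
  fun c => v ((colex n m).symm c).1 * w ((colex n m).symm c).2

/-- The embedding of generators; the base point goes to `0`. -/
def eta (n : ℕ) (a : Fin (n + 1)) : Fin n → ℤ := fun j => if a = j.succ then 1 else 0

theorem mul_colex {n m : ℕ} (v : Fin n → ℤ) (w : Fin m → ℤ) (i : Fin n) (j : Fin m) :
    mul v w (colex n m (i, j)) = v i * w j := by simp [mul]

theorem fun_ext {n m : ℕ} {x y : Fin (n * m) → ℤ}
    (h : ∀ i j, x (colex n m (i, j)) = y (colex n m (i, j))) : x = y := by
  funext c
  obtain ⟨⟨i, j⟩, rfl⟩ := (colex n m).surjective c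
  exact h i j

theorem map_id {n : ℕ} (v : Fin n → ℤ) : map (PtMap.id n) v = v := by
  funext j
  simp [map, PtMap.id]

theorem sum_aux {n m : ℕ} (g : PtMap n m) (a : Fin (n + 1)) (z : ℤ) (k : Fin m) :
    (∑ j : Fin n, if g j.succ = k.succ then (if a = j.succ then z else 0) else 0)
      = if g a = k.succ then z else 0 := by
  cases a using Fin.cases with
  | zero => simp [g.map_zero, (Fin.succ_ne_zero _).symm]
  | succ a =>
    rw [Finset.sum_eq_single a]
    · simp
    · intro b _ hb
      simp [Ne.symm hb]
    · simp

theorem map_comp {n m k : ℕ} (g : PtMap m k) (f : PtMap n m) (v : Fin n → ℤ) :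
    map (g.comp f) v = map g (map f v) := by
  funext l
  have h : ∀ j : Fin m, (if g j.succ = l.succ then map f v j else 0)
      = ∑ i : Fin n, if g j.succ = l.succ then (if f i.succ = j.succ then v i else 0) else 0 := by
    intro j
    split_ifs <;> simp [map]
  change _ = ∑ j : Fin m, (if g j.succ = l.succ then map f v j else 0)
  simp_rw [h]
  rw [Finset.sum_comm]
  simp_rw [sum_aux]
  rfl

theorem map_eta {n m : ℕ} (f : PtMap n m) (a : Fin (n + 1)) :
    map f (eta n a) = eta m (f a) := by
  funext j
  exact sum_aux f a 1 j

theorem mul_map {n n' m m' : ℕ} (f : PtMap n n') (g : PtMap m m') (x : Fin n → ℤ)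
    (y : Fin m → ℤ) : map (f.smash g) (mul x y) = mul (map f x) (map g y) := by
  refine fun_ext fun i j => ?_
  rw [mul_colex]
  simp only [map]
  rw [← (colex n m).sum_comp, Fintype.sum_prod_type, Finset.sum_mul_sum]
  refine Finset.sum_congr rfl fun a _ => Finset.sum_congr rfl fun b _ => ?_
  rw [← smashPt_succ a b, PtMap.smash_apply, mul_colex]
  simp only [smashPt_eq_succ, ite_and]
  split_ifs <;> simp

theorem mul_assoc {n m k : ℕ} (x : Fin n → ℤ) (y : Fin m → ℤ) (z : Fin k → ℤ) :
    map (PtMap.cast (Nat.mul_assoc n m k)) (mul (mul x y) z) = mul x (mul y z) := by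
  refine fun_ext fun a bc => ?_
  obtain ⟨⟨b, c⟩, rfl⟩ := (colex m k).surjective bc
  rw [mul_colex, mul_colex]
  simp only [map]
  rw [Finset.sum_eq_single (colex (n * m) k (colex n m (a, b), c))]
  · have h := PtMap.cast_assoc a.succ b.succ c.succ
    simp only [smashPt_succ] at h
    rw [if_pos h, mul_colex, mul_colex, _root_.mul_assoc]
  · intro e _ he
    refine if_neg fun h => he ?_
    have h2 := PtMap.cast_assoc a.succ b.succ c.succ
    simp only [smashPt_succ] at h2
    rw [← h2] at h
    refine Fin.succ_injective _ (Fin.ext ?_)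
    simpa [PtMap.cast] using congrArg Fin.val h
  · simp

theorem eta_mul {n m : ℕ} (a : Fin (n + 1)) (x : Fin m → ℤ) :
    mul (eta n a) x = map (PtMap.smashLeft a m) x := by
  refine fun_ext fun i j => ?_
  rw [mul_colex]
  simp only [map, PtMap.smashLeft, smashPt_eq_succ, eta]
  simp [ite_and]

theorem mul_eta {n m : ℕ} (x : Fin n → ℤ) (b : Fin (m + 1)) :
    mul x (eta m b) = map (PtMap.smashRight n b) x := by
  refine fun_ext fun i j => ?_
  rw [mul_colex]
  simp only [map, PtMap.smashRight, smashPt_eq_succ, eta]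
  simp [ite_and]

end HZ

/-- The Eilenberg–MacLane `Γ`-ring `HZ`. The reduced free abelian group on the pointed set `[n]` is
the group of vectors `(v_1, …, v_n)` of integers. -/
def HZ : DiscreteGammaRing.{0} where
  obj n := Fin n → ℤ
  zero _ := 0
  map := HZ.map
  map_pt f := by funext j; simp [HZ.map]
  map_id := HZ.map_id
  map_comp := HZ.map_comp
  eq_zero x := by funext j; exact j.elim0
  eta := HZ.eta
  eta_zero n := by funext j; simp [HZ.eta, (Fin.succ_ne_zero _).symm]
  eta_map := HZ.map_eta
  mul := HZ.mul
  zero_mul y := by funext c; simp [HZ.mul]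
  mul_zero x := by funext c; simp [HZ.mul]
  mul_map := HZ.mul_map
  mul_assoc := HZ.mul_assoc
  eta_mul := HZ.eta_mul
  mul_eta := HZ.mul_eta

/-- The element `(1, -1) ∈ HZ[2]`. -/
def HZ.diff : HZ.obj 2 := (![1, -1] : Fin 2 → ℤ)

/-! ### Formal difference laws -/

/-- The subset `A_+` of `{1, …, 2^k}`: `i ∈ A_+` if and only if the binary expansion of `i - 1` has
an even number of digits `1`. Its complement in `{1, …, 2^k}` is `A_-`. -/
def APlus (k : ℕ) : Set ℕ :=
  {i | 1 ≤ i ∧ i ≤ 2 ^ k ∧ Even ((Nat.digits 2 (i - 1)).count 1)}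

/-- The subset `A_-` of `{1, …, 2^k}`. -/
def AMinus (k : ℕ) : Set ℕ :=
  {i | 1 ≤ i ∧ i ≤ 2 ^ k ∧ Odd ((Nat.digits 2 (i - 1)).count 1)}

/-- The permutations of `{1, …, 2^k}` through which `Σ_{2^{k-1}} × Σ_{2^{k-1}}` acts in the special
action: those that permute `A_+` and permute `A_-`. -/
def IsSpecial (k : ℕ) (e : Equiv.Perm (Fin (2 ^ k))) : Prop :=
  ∀ i : Fin (2 ^ k), (i.val + 1 ∈ APlus k ↔ (e i).val + 1 ∈ APlus k) ∧
    (i.val + 1 ∈ AMinus k ↔ (e i).val + 1 ∈ AMinus k)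

/-- A formal difference law in `R`: an element `r ∈ R[2]` such that
1. `p_2^2(r) = 1` and `s_{1,2,1}^2(r) = 0`;
2. `p_1^2(r) r = r p_1^2(r) = σ(r)` in `R[2]`, where `σ` is the nontrivial permutation in `Σ_2`;
3. every power `r^k ∈ R[2^k]` is fixed under the special action;
4. `s_{i,j,l}^{2^k}(r^k) = d_l^{2^k-1} p_i^{2^k-1} p_j^{2^k}(r^k)` whenever `i < j` and one of `i, j`
   lies in `A_+` and the other one in `A_-`. -/
structure IsFormalDifferenceLaw (R : DiscreteGammaRing.{u}) (r : R.obj 2) : Prop where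
  p_two : R.map (PtMap.p 2 2 (by norm_num) (by norm_num)) r = R.one
  s_eq_zero : R.map (PtMap.s 2 1 2 1 (by norm_num) (by norm_num) (by norm_num) (by norm_num)
    (by norm_num)) r = R.zero 1
  neg_mul : (R.mul (R.map (PtMap.p 2 1 (by norm_num) (by norm_num)) r : R.obj 1) r : R.obj 2)
    = R.map (PtMap.perm (Equiv.swap 0 1)) r
  mul_neg : (R.mul r (R.map (PtMap.p 2 1 (by norm_num) (by norm_num)) r : R.obj 1) : R.obj 2)
    = R.map (PtMap.perm (Equiv.swap 0 1)) r
  special : ∀ (k : ℕ) (e : Equiv.Perm (Fin (2 ^ k))), IsSpecial k e →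
    R.map (PtMap.perm e) (R.pow r k) = R.pow r k
  cancel : ∀ (k i j l : ℕ) (hi : 1 ≤ i) (hij : i < j) (hj : j ≤ 2 ^ k) (hl : 1 ≤ l)
    (hlk : l ≤ 2 ^ k - 1),
    (i ∈ APlus k ∧ j ∈ AMinus k) ∨ (j ∈ APlus k ∧ i ∈ AMinus k) →
    R.map (PtMap.s (2 ^ k) i j l hi hij hj hl hlk) (R.pow r k)
      = R.map (PtMap.d (2 ^ k - 1) l hl hlk)
          (R.map (PtMap.p (2 ^ k - 1) i hi (by omega))
            (R.map (PtMap.p (2 ^ k) j (by omega) hj) (R.pow r k)))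

/-- The set of formal difference laws in `R`. -/
def FormalDifferenceLaw (R : DiscreteGammaRing.{u}) : Type u :=
  {r : R.obj 2 // IsFormalDifferenceLaw R r}

/-! Every integral vector `v` is the image of some power `(1, -1)^k` under a pointed map `f : [2^k]
→ [n]` (`HZ.representable`): such vectors form a subgroup containing the generators. Naturality
therefore forces `φ v = R.map f (r^k)`, which gives uniqueness (`MultMap.ext_of_pow`).

For existence this formula has to be independent of `k` and `f` (`map_eq_of_represents`). Since
`p_two` says that restricting `r` gives `1`, a power can be padded to a higher one, so the exponents
may be assumed equal. For a fixed exponent, `cancel` allows two elements of opposite sign in one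
fibre of `f` to be sent to the base point instead, without changing either image (`HZ.map_kill`,
`IsFormalDifferenceLaw.map_kill`). Repeating this makes `f` reduced: its fibres away from the base
point have a single sign. Two reduced maps with the same image of `(1, -1)^k` have equally many
elements of each sign in every fibre, so they differ by a sign-preserving permutation, which fixes
`r^k` by `special`. Multiplicativity comes from `r^k r^l = r^(k+l)`.

Conversely, `(1, -1)` is a formal difference law in `HZ`, and multiplicative maps preserve such
laws. -/

namespace PtMap

/-! ### Pointed maps: identifications, restrictions and deletion of a pair -/

theorem comp_apply {n m k : ℕ} (g : PtMap m k) (f : PtMap n m) (a : Fin (n + 1)) :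
    (g.comp f) a = g (f a) := rfl

theorem ext_succ {n m : ℕ} {f g : PtMap n m} (h : ∀ i : Fin n, f i.succ = g i.succ) : f = g := by
  ext1
  funext a
  cases a using Fin.cases with
  | zero => rw [f.map_zero, g.map_zero]
  | succ i => exact h i

/-- The pointed map with prescribed values on `{1, …, n}`. -/
def ofFun {n m : ℕ} (F : Fin n → Fin (m + 1)) : PtMap n m := ⟨Fin.cases 0 F, rfl⟩

@[simp] theorem ofFun_succ {n m : ℕ} (F : Fin n → Fin (m + 1)) (i : Fin n) :
    (ofFun F) i.succ = F i := rfl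

@[simp] theorem perm_succ {n : ℕ} (e : Equiv.Perm (Fin n)) (i : Fin n) :
    (perm e) i.succ = (e i).succ := rfl

theorem cast_comp_cast {a b c : ℕ} (h : a = b) (h' : b = c) :
    (cast h').comp (cast h) = cast (h.trans h') := rfl

theorem cast_rfl (a : ℕ) : cast (rfl : a = a) = PtMap.id a := rfl

theorem smash_id_id (n m : ℕ) : smash (PtMap.id n) (PtMap.id m) = PtMap.id (n * m) := by
  refine ext_succ fun c => ?_
  obtain ⟨⟨i, j⟩, rfl⟩ := (colex n m).surjective c
  rw [← smashPt_succ, smash_apply]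
  rfl

theorem smash_cast_id {a b : ℕ} (h : a = b) (m : ℕ) :
    smash (cast h) (PtMap.id m) = cast (by rw [h]) := by
  subst h
  exact smash_id_id a m

theorem cast_comp_smashRight_one (n : ℕ) :
    (cast (Nat.mul_one n)).comp (smashRight n (1 : Fin (1 + 1))) = PtMap.id n := by
  refine ext_succ fun i => ?_
  ext
  change (smashPt i.succ (Fin.succ (0 : Fin 1))).val = _
  rw [smashPt_succ, Fin.val_succ, colex_val]
  simp [PtMap.id]

/-- The map `f` altered so that it sends `i` and `j` to the base point. -/
def kill {n m : ℕ} (f : PtMap n m) (i j : Fin n) : PtMap n m :=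
  ofFun fun a => if a = i ∨ a = j then 0 else f a.succ

theorem kill_succ {n m : ℕ} (f : PtMap n m) (i j a : Fin n) :
    (kill f i j) a.succ = if a = i ∨ a = j then 0 else f a.succ := rfl

theorem kill_comm {n m : ℕ} (f : PtMap n m) (i j : Fin n) : kill f i j = kill f j i := by
  simp only [kill, or_comm]

theorem p_self (n i : ℕ) (h1 : 1 ≤ i) (h2 : i ≤ n) (a : Fin (n + 1)) (ha : a.val = i) :
    p n i h1 h2 a = 0 := by
  simp [p, ha]

theorem p_of_lt (n i : ℕ) (h1 : 1 ≤ i) (h2 : i ≤ n) (a : Fin (n + 1)) (ha : a.val < i) :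
    (p n i h1 h2 a).val = a.val := by
  simp [p, ha]

theorem p_of_gt (n i : ℕ) (h1 : 1 ≤ i) (h2 : i ≤ n) (a : Fin (n + 1)) (ha : i < a.val) :
    (p n i h1 h2 a).val = a.val - 1 := by
  simp only [p]
  rw [dif_neg (by omega), if_neg (by omega)]

theorem d_val (n j : ℕ) (h1 : 1 ≤ j) (h2 : j ≤ n) (a : Fin (n - 1 + 1)) :
    (d n j h1 h2 a).val = if a.val < j then a.val else a.val + 1 := by
  simp only [d]
  split_ifs <;> rfl

/-! ### Fibres of the summing maps and factorization through them -/

section SumMap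

variable (n i j k : ℕ) (hi : 1 ≤ i) (hij : i < j) (hj : j ≤ n) (hk : 1 ≤ k) (hkn : k ≤ n - 1)

theorem s_pair (a : Fin (n + 1)) (ha : a.val = i ∨ a.val = j) :
    (s n i j k hi hij hj hk hkn a).val = k := by
  simp only [s]
  rw [if_pos ha]

theorem s_other (a : Fin (n + 1)) (ha : ¬ (a.val = i ∨ a.val = j)) :
    s n i j k hi hij hj hk hkn a
      = d (n - 1) k hk hkn (p (n - 1) i hi (by omega) (p n j (by omega) hj a)) := by
  simp only [s]
  rw [if_neg ha]

theorem d_p_p_pair (a : Fin (n + 1)) (ha : a.val = i ∨ a.val = j) :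
    d (n - 1) k hk hkn (p (n - 1) i hi (by omega) (p n j (by omega) hj a)) = 0 := by
  have h : p (n - 1) i hi (by omega) (p n j (by omega) hj a) = 0 := by
    rcases ha with ha | ha
    -- As `i < j`, deleting `j` first leaves `i` in its place, so `p_i` then removes it.
    · exact p_self _ _ _ _ _ ((p_of_lt n j _ hj a (by omega)).trans ha)
    · rw [p_self n j _ hj a ha, map_zero]
  rw [h, map_zero]

theorem p_p_val (a : Fin (n + 1)) (ha : ¬ (a.val = i ∨ a.val = j)) :
    (p (n - 1) i hi (by omega) (p n j (by omega) hj a)).val =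
      if a.val < i then a.val else if a.val < j then a.val - 1 else a.val - 2 := by
  have hj' : (p n j (by omega) hj a).val = if a.val < j then a.val else a.val - 1 := by
    split_ifs with h
    · exact p_of_lt _ _ _ _ _ h
    · exact p_of_gt _ _ _ _ _ (by omega)
  by_cases h1 : a.val < i
  · rw [if_pos (by omega)] at hj'
    rw [p_of_lt _ _ _ _ _ (by omega), hj', if_pos h1]
  · rw [p_of_gt _ _ _ _ _ (by split_ifs at hj' <;> omega), hj', if_neg h1]
    split_ifs <;> omega

/-- Deleting `i` and `j` is injective on the remaining elements, and the gap left by `d` reserves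
the value `k` for the pair. -/
theorem s_eq_s (a b : Fin (n + 1))
    (h : s n i j k hi hij hj hk hkn a = s n i j k hi hij hj hk hkn b) :
    a = b ∨ ((a.val = i ∨ a.val = j) ∧ (b.val = i ∨ b.val = j)) := by
  have key : ∀ c : Fin (n + 1), ¬ (c.val = i ∨ c.val = j) →
      ∃ x, x = (if c.val < i then c.val else if c.val < j then c.val - 1 else c.val - 2) ∧
        (s n i j k hi hij hj hk hkn c).val = if x < k then x else x + 1 := by
    intro c hc
    refine ⟨_, rfl, ?_⟩
    rw [s_other n i j k hi hij hj hk hkn c hc, d_val, p_p_val n i j k hi hij hj hk hkn c hc]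
  have hv := congrArg Fin.val h
  by_cases ha : a.val = i ∨ a.val = j <;> by_cases hb : b.val = i ∨ b.val = j
  · exact Or.inr ⟨ha, hb⟩
  · obtain ⟨x, -, hx⟩ := key b hb
    rw [s_pair n i j k hi hij hj hk hkn a ha, hx] at hv
    split_ifs at hv <;> omega
  · obtain ⟨x, -, hx⟩ := key a ha
    rw [s_pair n i j k hi hij hj hk hkn b hb, hx] at hv
    split_ifs at hv <;> omega
  · obtain ⟨x, hx, hx'⟩ := key a ha
    obtain ⟨y, hy, hy'⟩ := key b hb
    rw [hx', hy'] at hv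
    have hxy : x = y := by split_ifs at hv <;> omega
    left
    ext
    split_ifs at hx hy <;> omega

/-- A map that agrees on `i` and `j` factors through the summing map, and deleting `i` and `j`
factors through the same map. -/
theorem exists_factor_s {m : ℕ} (f : PtMap n m) (i' j' : Fin n) (hi' : i'.val + 1 = i)
    (hj' : j'.val + 1 = j) (hf : f i'.succ = f j'.succ) :
    ∃ h : PtMap (n - 1) m, h.comp (s n i j k hi hij hj hk hkn) = f ∧
      h.comp ((d (n - 1) k hk hkn).comp ((p (n - 1) i hi (by omega)).comp
        (p n j (by omega) hj))) = kill f i' j' := by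
  have hpair : ∀ a : Fin (n + 1), a.val = i ∨ a.val = j → f a = f i'.succ := by
    rintro a (ha | ha)
    · congr 1
      ext
      simp [ha, hi']
    · rw [hf]
      congr 1
      ext
      simp [ha, hj']
  have hfac : Function.FactorsThrough f (s n i j k hi hij hj hk hkn) := by
    intro a b hab
    rcases s_eq_s n i j k hi hij hj hk hkn a b hab with rfl | ⟨ha, hb⟩
    · rfl
    · rw [hpair a ha, hpair b hb]
  have hext : ∀ a, Function.extend (s n i j k hi hij hj hk hkn) f (fun _ => 0)
      (s n i j k hi hij hj hk hkn a) = f a := fun a => hfac.extend_apply _ a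
  -- The summing map is onto, so the default value `0` is never taken.
  refine ⟨⟨Function.extend (s n i j k hi hij hj hk hkn) f (fun _ => 0), ?_⟩, ?_, ?_⟩
  · have := hext 0
    rwa [map_zero, map_zero] at this
  · ext1
    funext a
    exact hext a
  · refine ext_succ fun a => ?_
    simp only [comp_apply]
    have hiff : (a = i' ∨ a = j') ↔ (a.succ.val = i ∨ a.succ.val = j) := by
      simp only [Fin.ext_iff, Fin.val_succ]
      omega
    rw [kill_succ]
    split_ifs with ha
    · rw [d_p_p_pair n i j k hi hij hj hk hkn _ (hiff.1 ha)]
      have := hext 0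
      rwa [map_zero, map_zero] at this
    · rw [← s_other n i j k hi hij hj hk hkn _ (fun h => ha (hiff.2 h))]
      exact hext _

end SumMap

end PtMap

/-! ### The signs `(1, -1)^k` -/

/-- The number of digits `1` in the binary expansion. -/
def binaryOnes (n : ℕ) : ℕ := (Nat.digits 2 n).count 1

theorem binaryOnes_div (n : ℕ) : binaryOnes n = binaryOnes (n / 2) + n % 2 := by
  rcases Nat.eq_zero_or_pos n with rfl | hn
  · simp [binaryOnes]
  · rw [binaryOnes, Nat.digits_def' (by norm_num) hn, List.count_cons, binaryOnes]
    rcases Nat.mod_two_eq_zero_or_one n with h | h <;> simp [h]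

/-- The summand `2^k` is a new leading digit. Halving drops the last digit and lowers `k` by one,
which drives the induction. -/
theorem binaryOnes_add_two_pow (k i : ℕ) (hi : i < 2 ^ k) :
    binaryOnes (i + 2 ^ k) = binaryOnes i + 1 := by
  induction k generalizing i with
  | zero =>
    obtain rfl : i = 0 := by simpa using hi
    simp [binaryOnes]
  | succ k ih =>
    rw [pow_succ] at hi ⊢
    rw [binaryOnes_div, binaryOnes_div i]
    have h1 : (i + 2 ^ k * 2) / 2 = i / 2 + 2 ^ k := by omega
    have h2 : (i + 2 ^ k * 2) % 2 = i % 2 := by omega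
    rw [h1, h2, ih (i / 2) (by omega)]
    omega

namespace HZ

/-- The element `(1, -1)^k` of `HZ[2^k]`. -/
def signs (k : ℕ) : Fin (2 ^ k) → ℤ := HZ.pow HZ.diff k

/-- In the inverse lexicographical order, multiplying by `(1, -1)` appends a negated copy at offset
`2^k`; the offset adds one binary digit `1`. -/
theorem signs_eq (k : ℕ) (i : Fin (2 ^ k)) : signs k i = (-1) ^ binaryOnes i.val := by
  induction k with
  | zero =>
    obtain rfl : i = (0 : Fin 1) := Subsingleton.elim (α := Fin 1) _ _
    simp [binaryOnes]
    rfl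
  | succ k ih =>
    obtain ⟨⟨a, b⟩, rfl⟩ := (colex (2 ^ k) 2).surjective i
    have h : signs (k + 1) (colex (2 ^ k) 2 (a, b)) = signs k a * ![1, -1] b :=
      mul_colex (signs k) ![1, -1] a b
    rw [h, ih]
    have hv : (colex (2 ^ k) 2 (a, b)).val = a.val + 2 ^ k * b.val := colex_val a b
    change _ = (-1 : ℤ) ^ binaryOnes (colex (2 ^ k) 2 (a, b)).val
    rw [hv]
    fin_cases b
    · simp
    · simp [binaryOnes_add_two_pow k a.val a.isLt, pow_succ]

theorem signs_eq_one_or (k : ℕ) (i : Fin (2 ^ k)) : signs k i = 1 ∨ signs k i = -1 := by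
  rw [signs_eq]
  exact neg_one_pow_eq_or ℤ _

theorem mem_APlus (k : ℕ) (i : Fin (2 ^ k)) : i.val + 1 ∈ APlus k ↔ signs k i = 1 := by
  have : i.val + 1 ≤ 2 ^ k := i.isLt
  simp [APlus, this, signs_eq, neg_one_pow_eq_one_iff_even (R := ℤ) (by norm_num), binaryOnes]

theorem mem_AMinus (k : ℕ) (i : Fin (2 ^ k)) : i.val + 1 ∈ AMinus k ↔ signs k i = -1 := by
  have : i.val + 1 ≤ 2 ^ k := i.isLt
  simp [AMinus, this, signs_eq, neg_one_pow_eq_neg_one_iff_odd (R := ℤ) (by norm_num), binaryOnes]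

theorem isSpecial_iff (k : ℕ) (e : Equiv.Perm (Fin (2 ^ k))) :
    IsSpecial k e ↔ ∀ i, signs k (e i) = signs k i := by
  simp only [IsSpecial, mem_APlus, mem_AMinus]
  refine forall_congr' fun i => ?_
  rcases signs_eq_one_or k i with h | h <;> rcases signs_eq_one_or k (e i) with h' | h' <;>
    simp [h, h']

theorem opposite_iff (k : ℕ) (i j : Fin (2 ^ k)) :
    ((i.val + 1 ∈ APlus k ∧ j.val + 1 ∈ AMinus k) ∨
      (j.val + 1 ∈ APlus k ∧ i.val + 1 ∈ AMinus k)) ↔ signs k i + signs k j = 0 := by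
  simp only [mem_APlus, mem_AMinus]
  rcases signs_eq_one_or k i with h | h <;> rcases signs_eq_one_or k j with h' | h' <;>
    simp [h, h']

/-- Deleting a cancelling pair in a fibre does not change the image. -/
theorem map_kill {n m : ℕ} (v : Fin n → ℤ) (f : PtMap n m) (i j : Fin n) (hij : i ≠ j)
    (hv : v i + v j = 0) (hf : f i.succ = f j.succ) : map (f.kill i j) v = map f v := by
  funext t
  rw [← sub_eq_zero]
  simp only [map]
  rw [← Finset.sum_sub_distrib, Finset.sum_eq_add i j hij]
  · simp only [PtMap.kill_succ, true_or, or_true, if_true, (Fin.succ_ne_zero t).symm, if_false, hf]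
    split_ifs <;> linarith
  · rintro a - ⟨h1, h2⟩
    simp [PtMap.kill_succ, h1, h2]
  · simp
  · simp

theorem map_perm {n : ℕ} (v : Fin n → ℤ) (e : Equiv.Perm (Fin n)) (hv : ∀ i, v (e i) = v i) :
    map (PtMap.perm e) v = v := by
  funext t
  simp only [map, PtMap.perm_succ, Fin.succ_inj]
  rw [Finset.sum_eq_single (e.symm t)]
  · simp [← hv (e.symm t)]
  · intro b _ hb
    exact if_neg fun h => hb (by simp [← h])
  · simp

end HZ

/-! ### Reduced maps -/

theorem exists_perm_of_card_fiber {α β : Type*} [Fintype α] [DecidableEq β] (F G : α → β)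
    (h : ∀ c, (Finset.univ.filter fun a => F a = c).card
      = (Finset.univ.filter fun a => G a = c).card) :
    ∃ e : Equiv.Perm α, ∀ a, G (e a) = F a := by
  have hc : ∀ c, Nonempty ({a // F a = c} ≃ {a // G a = c}) := fun c => by
    refine Fintype.card_eq.1 ?_
    rw [Fintype.card_subtype, Fintype.card_subtype]
    exact h c
  exact ⟨Equiv.ofFiberEquiv fun c => (hc c).some, fun a => Equiv.ofFiberEquiv_map _ a⟩

/-- A map is reduced for the signs `v` if no fibre over a point other than the base point contains
elements of different signs. -/
def PtMap.IsReduced {n m : ℕ} (v : Fin n → ℤ) (f : PtMap n m) : Prop :=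
  ∀ i j, f i.succ = f j.succ → f i.succ ≠ 0 → v i = v j

/-- The number of elements of a given sign in a fibre. -/
def signedCard {n m : ℕ} (v : Fin n → ℤ) (f : PtMap n m) (t : Fin (m + 1)) (z : ℤ) : ℕ :=
  (Finset.univ.filter fun i => f i.succ = t ∧ v i = z).card

/-- The coefficient is a difference of two counts. For a reduced map one of them vanishes, so the
coefficient determines both. -/
theorem map_eq_signedCard_sub {n m : ℕ} {v : Fin n → ℤ} (hv : ∀ i, v i = 1 ∨ v i = -1)
    (f : PtMap n m) (t : Fin m) :
    HZ.map f v t = (signedCard v f t.succ 1 : ℤ) - signedCard v f t.succ (-1) := by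
  simp only [HZ.map, signedCard, Finset.card_filter, Nat.cast_sum]
  rw [← Finset.sum_sub_distrib]
  refine Finset.sum_congr rfl fun i _ => ?_
  rcases hv i with h | h <;> by_cases h' : f i.succ = t.succ <;> simp [h, h']

theorem PtMap.IsReduced.signedCard_eq_zero {n m : ℕ} {v : Fin n → ℤ} {f : PtMap n m}
    (hf : f.IsReduced v) (t : Fin m) :
    signedCard v f t.succ 1 = 0 ∨ signedCard v f t.succ (-1) = 0 := by
  by_contra! h
  obtain ⟨i, hi⟩ := Finset.card_ne_zero.1 h.1
  obtain ⟨j, hj⟩ := Finset.card_ne_zero.1 h.2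
  simp only [Finset.mem_filter, Finset.mem_univ, true_and] at hi hj
  have := hf i j (hi.1.trans hj.1.symm) (by rw [hi.1]; exact Fin.succ_ne_zero t)
  rw [hi.2, hj.2] at this
  norm_num at this

/-- The image in `HZ` does not see the fibre over the base point; its signed counts are recovered
from these totals. -/
theorem sum_signedCard {n m : ℕ} (v : Fin n → ℤ) (f : PtMap n m) (z : ℤ) :
    ∑ t, signedCard v f t z = (Finset.univ.filter fun i => v i = z).card := by
  rw [Finset.card_eq_sum_card_fiberwise (f := fun i : Fin n => f i.succ) (t := Finset.univ)
    (fun _ _ => Finset.mem_coe.2 (Finset.mem_univ _))]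
  refine Finset.sum_congr rfl fun t _ => ?_
  rw [signedCard, Finset.filter_filter]
  simp only [and_comm]

/-- Two reduced maps under which a vector of signs has the same image differ by a permutation that
preserves the signs. -/
theorem PtMap.IsReduced.exists_perm {n m : ℕ} {v : Fin n → ℤ} (hv : ∀ i, v i = 1 ∨ v i = -1)
    {f g : PtMap n m} (hf : f.IsReduced v) (hg : g.IsReduced v)
    (h : HZ.map f v = HZ.map g v) :
    ∃ e : Equiv.Perm (Fin n), (∀ i, v (e i) = v i) ∧ g.comp (PtMap.perm e) = f := by
  have hsucc : ∀ t : Fin m, signedCard v f t.succ 1 = signedCard v g t.succ 1 ∧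
      signedCard v f t.succ (-1) = signedCard v g t.succ (-1) := by
    intro t
    have ht := congrFun h t
    rw [map_eq_signedCard_sub hv, map_eq_signedCard_sub hv] at ht
    have h1 := hf.signedCard_eq_zero t
    have h2 := hg.signedCard_eq_zero t
    omega
  have hall : ∀ (z : ℤ), (z = 1 ∨ z = -1) → ∀ t, signedCard v f t z = signedCard v g t z := by
    intro z hz
    have hs : ∀ t : Fin m, signedCard v f t.succ z = signedCard v g t.succ z := by
      intro t
      rcases hz with rfl | rfl
      · exact (hsucc t).1
      · exact (hsucc t).2
    intro t
    cases t using Fin.cases with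
    | zero =>
      have h0 := (sum_signedCard v f z).trans (sum_signedCard v g z).symm
      rw [Fin.sum_univ_succ, Fin.sum_univ_succ, Finset.sum_congr rfl fun t _ => hs t] at h0
      exact Nat.add_right_cancel h0
    | succ t => exact hs t
  obtain ⟨e, he⟩ := exists_perm_of_card_fiber (fun i => (f i.succ, v i))
    (fun i => (g i.succ, v i)) (by
      rintro ⟨t, z⟩
      simp only [Prod.mk.injEq]
      by_cases hz : z = 1 ∨ z = -1
      · exact hall z hz t
      · have hz' : ∀ i, v i ≠ z := by
          rintro i rfl
          exact hz (hv i)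
        simp [hz'])
  simp only [Prod.mk.injEq] at he
  exact ⟨e, fun i => (he i).2, PtMap.ext_succ fun i => (he i).1⟩

/-- If an element is invariant under the deletion of cancelling pairs, then every map can be
replaced by a reduced one. -/
theorem exists_reduced {X : Type*} {n m : ℕ} {v : Fin n → ℤ} (hv : ∀ i, v i = 1 ∨ v i = -1)
    (F : PtMap n m → X) (hF : ∀ (f : PtMap n m) (i j : Fin n), i ≠ j → v i + v j = 0 →
      f i.succ = f j.succ → F (f.kill i j) = F f) (f : PtMap n m) :
    ∃ g : PtMap n m, g.IsReduced v ∧ HZ.map g v = HZ.map f v ∧ F g = F f := by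
  -- Induction on the number of elements not sent to the base point; killing a pair in a fibre off
  -- the base point lowers it.
  induction hN : (Finset.univ.filter fun i : Fin n => f i.succ ≠ 0).card using
    Nat.strong_induction_on generalizing f with
  | _ N ih =>
    by_cases hf : f.IsReduced v
    · exact ⟨f, hf, rfl, rfl⟩
    · simp only [PtMap.IsReduced, not_forall] at hf
      obtain ⟨i, j, hij, h0, hvij⟩ := hf
      have hsum : v i + v j = 0 := by
        rcases hv i with h | h <;> rcases hv j with h' | h' <;> rw [h, h'] at hvij ⊢ <;>
          simp at hvij ⊢
      have hne : i ≠ j := fun h => hvij (by rw [h])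
      obtain ⟨g, hg, hg1, hg2⟩ := ih _ (by
        rw [← hN]
        refine Finset.card_lt_card (Finset.ssubset_iff_of_subset ?_ |>.2 ⟨i, ?_, ?_⟩)
        · intro a
          simp only [Finset.mem_filter, Finset.mem_univ, true_and, PtMap.kill_succ]
          simp
        · simpa using h0
        · simp [PtMap.kill_succ]) (f.kill i j) rfl
      exact ⟨g, hg, hg1.trans (HZ.map_kill v f i j hne hsum hij),
        hg2.trans (hF f i j hne hsum hij)⟩

/-! ### Powers and padding -/

namespace DiscreteGammaRing

variable (R : DiscreteGammaRing.{u})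

theorem map_cast_mul_one {n : ℕ} (x : R.obj n) :
    R.map (PtMap.cast (Nat.mul_one n)) (R.mul x R.one) = x := by
  rw [one, R.mul_eta, ← R.map_comp, PtMap.cast_comp_smashRight_one, R.map_id]

theorem one_mul {n : ℕ} (x : R.obj n) :
    R.map (PtMap.cast (Nat.one_mul n)) (R.mul R.one x) = x := by
  rw [one, R.eta_mul, ← R.map_comp]
  convert R.map_id x
  refine PtMap.ext_succ fun i => ?_
  ext
  change (smashPt (Fin.succ (0 : Fin 1)) i.succ).val = _
  rw [smashPt_succ, Fin.val_succ, colex_val]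
  simp [PtMap.id]

theorem pow_succ {n : ℕ} (x : R.obj n) (k : ℕ) : R.pow x (k + 1) = R.mul (R.pow x k) x := rfl

theorem pow_one_two (x : R.obj 2) : R.pow x 1 = x :=
  (R.map_id (n := 2) _).symm.trans (R.one_mul x)

/-- The order on smash products makes associativity a mere cast, so all identifications in the
induction compose to one cast. -/
theorem pow_add {n : ℕ} (x : R.obj n) (k l : ℕ) :
    R.map (PtMap.cast (Nat.pow_add n k l).symm) (R.mul (R.pow x k) (R.pow x l))
      = R.pow x (k + l) := by
  induction l with
  | zero => exact R.map_cast_mul_one (R.pow x k)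
  | succ l ih =>
    have h : R.mul (R.pow x (k + l)) x
        = R.map ((PtMap.cast (Nat.pow_add n k l).symm).smash (PtMap.id n))
          (R.mul (R.mul (R.pow x k) (R.pow x l)) x) := by
      rw [R.mul_map, R.map_id, ih]
    refine Eq.trans ?_ h.symm
    rw [PtMap.smash_cast_id, pow_succ]
    refine (congrArg _ (R.mul_assoc _ _ _).symm).trans ?_
    exact (R.map_comp _ _ _).symm

end DiscreteGammaRing

theorem MultMap.app_pow {R : DiscreteGammaRing.{u}} {R' : DiscreteGammaRing.{v}}
    (φ : MultMap R R') {n : ℕ} (x : R.obj n) (k : ℕ) :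
    φ.app (n ^ k) (R.pow x k) = R'.pow (φ.app n x) k := by
  induction k with
  | zero => exact φ.app_eta 1 1
  | succ k ih =>
    rw [R'.pow_succ, ← ih]
    exact φ.app_mul _ _

/-- The map `[2^{k+1}] → [n]` that is `f` on the first half and trivial on the second half. -/
def PtMap.extendSucc {k n : ℕ} (f : PtMap (2 ^ k) n) : PtMap (2 ^ (k + 1)) n :=
  f.comp ((PtMap.cast (Nat.mul_one (2 ^ k))).comp
    (PtMap.smash (PtMap.id (2 ^ k)) (PtMap.p 2 2 (by norm_num) (by norm_num))))

/-- Restricting the last factor of `r^k r` to its first element turns the product into `r^k · 1`. -/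
theorem map_extendSucc {R : DiscreteGammaRing.{u}} {r : R.obj 2}
    (hr : R.map (PtMap.p 2 2 (by norm_num) (by norm_num)) r = R.one) {k n : ℕ}
    (f : PtMap (2 ^ k) n) : R.map f.extendSucc (R.pow r (k + 1)) = R.map f (R.pow r k) := by
  have h := R.mul_map (PtMap.id (2 ^ k)) (PtMap.p 2 2 (by norm_num) (by norm_num)) (R.pow r k) r
  rw [R.map_id, hr] at h
  refine (R.map_comp f _ _).trans (congrArg (R.map f) ?_)
  refine (R.map_comp _ _ _).trans ?_
  refine (congrArg _ h).trans ?_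
  exact R.map_cast_mul_one (R.pow r k)

/-- The map `[2^{k+m}] → [n]` that is `f` on the first `2^k` elements and trivial on the others. -/
def PtMap.extendAdd {k n : ℕ} (f : PtMap (2 ^ k) n) : ∀ m : ℕ, PtMap (2 ^ (k + m)) n
  | 0 => f
  | m + 1 => (extendAdd f m).extendSucc

theorem map_extendAdd {R : DiscreteGammaRing.{u}} {r : R.obj 2}
    (hr : R.map (PtMap.p 2 2 (by norm_num) (by norm_num)) r = R.one) {k n : ℕ}
    (f : PtMap (2 ^ k) n) (m : ℕ) :
    R.map (f.extendAdd m) (R.pow r (k + m)) = R.map f (R.pow r k) := by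
  induction m with
  | zero => rfl
  | succ m ih => exact (map_extendSucc hr _).trans ih

/-! ### The element `(1, -1)` is a formal difference law -/

theorem HZ.diff_p_two :
    HZ.toDiscreteGammaSpace.map (PtMap.p 2 2 (by norm_num) (by norm_num)) HZ.diff
      = DiscreteGammaRing.one HZ := by
  change HZ.map _ ![1, -1] = HZ.eta 1 1
  decide

theorem HZ.diff_isFormalDifferenceLaw : IsFormalDifferenceLaw HZ HZ.diff where
  p_two := HZ.diff_p_two
  s_eq_zero := by
    change HZ.map _ ![1, -1] = 0
    decide
  neg_mul := by
    change HZ.mul (HZ.map (n := 2) (m := 1) _ ![1, -1]) ![1, -1] = HZ.map (n := 2) _ ![1, -1]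
    decide
  mul_neg := by
    change HZ.mul ![1, -1] (HZ.map (n := 2) (m := 1) _ ![1, -1]) = HZ.map (n := 2) _ ![1, -1]
    decide
  special k e he := HZ.map_perm (HZ.signs k) e ((HZ.isSpecial_iff k e).1 he)
  cancel k i j l hi hij hj hl hlk h := by
    obtain ⟨i, rfl⟩ : ∃ i', i = i' + 1 := ⟨i - 1, by omega⟩
    obtain ⟨j, rfl⟩ : ∃ j', j = j' + 1 := ⟨j - 1, by omega⟩
    have hs := (HZ.opposite_iff k ⟨i, by omega⟩ ⟨j, by omega⟩).1 h
    have hf : (PtMap.s (2 ^ k) (i + 1) (j + 1) l hi hij hj hl hlk) (Fin.succ ⟨i, by omega⟩)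
        = (PtMap.s (2 ^ k) (i + 1) (j + 1) l hi hij hj hl hlk) (Fin.succ ⟨j, by omega⟩) := by
      ext
      rw [PtMap.s_pair, PtMap.s_pair] <;> simp
    obtain ⟨g, hg1, hg2⟩ := PtMap.exists_factor_s (2 ^ k) (i + 1) (j + 1) l hi hij hj hl hlk
      (PtMap.s (2 ^ k) (i + 1) (j + 1) l hi hij hj hl hlk) ⟨i, by omega⟩ ⟨j, by omega⟩ rfl rfl hf
    -- The pair cancels inside its fibre under `s`, and killing it in `s` yields exactly `d ∘ p_i ∘
    -- p_j`.
    have hk := HZ.map_kill (HZ.signs k) _ ⟨i, by omega⟩ ⟨j, by omega⟩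
      (by simp only [ne_eq, Fin.mk.injEq]; omega) hs hf
    refine hk.symm.trans ?_
    refine Eq.trans ?_ (HZ.map_comp _ _ _)
    refine Eq.trans ?_ (HZ.map_comp _ _ _)
    congr 1
    refine PtMap.ext_succ fun a => ?_
    rw [PtMap.kill_succ]
    have hiff : (a = ⟨i, by omega⟩ ∨ a = ⟨j, by omega⟩) ↔
        (a.succ.val = i + 1 ∨ a.succ.val = j + 1) := by
      simp [Fin.ext_iff]
    split_ifs with ha
    · exact (PtMap.d_p_p_pair (2 ^ k) (i + 1) (j + 1) l hi hij hj hl hlk _ (hiff.1 ha)).symm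
    · exact PtMap.s_other (2 ^ k) (i + 1) (j + 1) l hi hij hj hl hlk _ fun h => ha (hiff.2 h)

/-- Multiplicative maps preserve formal difference laws. -/
theorem IsFormalDifferenceLaw.app {R : DiscreteGammaRing.{u}} {R' : DiscreteGammaRing.{v}}
    {r : R.obj 2} (hr : IsFormalDifferenceLaw R r) (φ : MultMap R R') :
    IsFormalDifferenceLaw R' (φ.app 2 r) where
  p_two := by
    rw [← φ.naturality, hr.p_two]
    exact φ.app_eta 1 1
  s_eq_zero := by rw [← φ.naturality, hr.s_eq_zero, φ.app_zero]
  neg_mul := by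
    rw [← φ.naturality, ← φ.naturality, ← hr.neg_mul]
    exact (φ.app_mul (n := 1) (m := 2) _ _).symm
  mul_neg := by
    rw [← φ.naturality, ← φ.naturality, ← hr.mul_neg]
    exact (φ.app_mul (n := 2) (m := 1) _ _).symm
  special k e he := by rw [← φ.app_pow, ← φ.naturality, hr.special k e he]
  cancel k i j l hi hij hj hl hlk h := by
    rw [← φ.app_pow]
    simp only [← φ.naturality]
    rw [hr.cancel k i j l hi hij hj hl hlk h]

/-! ### Every integral vector is an image of some `(1, -1)^k` -/

namespace HZ

/-- The vector `v` is the image of `(1, -1)^k` under `f`. -/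
def Represents {n : ℕ} (v : Fin n → ℤ) {k : ℕ} (f : PtMap (2 ^ k) n) : Prop :=
  map f (signs k) = v

theorem Represents.extendAdd {n k : ℕ} {v : Fin n → ℤ} {f : PtMap (2 ^ k) n}
    (h : Represents v f) (m : ℕ) : Represents v (f.extendAdd m) :=
  (map_extendAdd HZ.diff_p_two f m).trans h

theorem Represents.map {n m k : ℕ} {v : Fin n → ℤ} {f : PtMap (2 ^ k) n}
    (h : Represents v f) (g : PtMap n m) : Represents (map g v) (g.comp f) := by
  rw [Represents, map_comp, h]

theorem represents_eta (n : ℕ) (a : Fin (n + 1)) :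
    Represents (k := 0) (eta n a) (PtMap.ofFun (n := 1) fun _ => a) :=
  HZ.map_eta (PtMap.ofFun (n := 1) fun _ => a) 1

/-- The representation of a product. -/
def mulRep {n m k l : ℕ} (f : PtMap (2 ^ k) n) (g : PtMap (2 ^ l) m) :
    PtMap (2 ^ (k + l)) (n * m) :=
  (f.smash g).comp (PtMap.cast (Nat.pow_add 2 k l))

end HZ

/-- Used in `HZ` to represent products of vectors, and in `R` to show that the constructed map is
multiplicative. -/
theorem map_mulRep (R : DiscreteGammaRing.{u}) (r : R.obj 2) {n m k l : ℕ} (f : PtMap (2 ^ k) n)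
    (g : PtMap (2 ^ l) m) : R.map (HZ.mulRep f g) (R.pow r (k + l))
      = R.mul (R.map f (R.pow r k)) (R.map g (R.pow r l)) := by
  rw [← R.mul_map, HZ.mulRep, R.map_comp, ← R.pow_add, ← R.map_comp (PtMap.cast _),
    PtMap.cast_comp_cast, PtMap.cast_rfl, R.map_id]

namespace HZ

theorem Represents.mul {n m k l : ℕ} {v : Fin n → ℤ} {w : Fin m → ℤ} {f : PtMap (2 ^ k) n}
    {g : PtMap (2 ^ l) m} (hf : Represents v f) (hg : Represents w g) :
    Represents (mul v w) (mulRep f g) := by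
  rw [← hf, ← hg]
  exact map_mulRep HZ HZ.diff f g

/-- The vector is an image of some power of `(1, -1)`. -/
def Representable {n : ℕ} (v : Fin n → ℤ) : Prop :=
  ∃ (k : ℕ) (f : PtMap (2 ^ k) n), Represents v f

theorem Representable.map {n m : ℕ} {v : Fin n → ℤ} (h : Representable v) (g : PtMap n m) :
    Representable (map g v) := by
  obtain ⟨k, f, hf⟩ := h
  exact ⟨k, _, hf.map g⟩

theorem Representable.mul {n m : ℕ} {v : Fin n → ℤ} {w : Fin m → ℤ} (hv : Representable v)
    (hw : Representable w) : Representable (mul v w) := by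
  obtain ⟨k, f, hf⟩ := hv
  obtain ⟨l, g, hg⟩ := hw
  exact ⟨_, _, hf.mul hg⟩

theorem representable_signs (k : ℕ) : Representable (signs k) := ⟨k, PtMap.id _, map_id _⟩

theorem representable_one_one : Representable ![1, 1] := by
  -- Here `(1, -1)^2 = (1, -1, -1, 1)`, and the map keeps the two positive entries.
  have h : ![1, 1] = HZ.map (PtMap.ofFun ![1, 0, 0, 2]) (mul ![1, -1] ![1, -1]) := by decide
  have h2 : Representable ![1, -1] := by
    have := representable_signs 1
    rwa [show signs 1 = ![1, -1] from DiscreteGammaRing.pow_one_two HZ HZ.diff] at this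
  rw [h]
  exact (h2.mul h2).map (n := 4) _

/-- The map `[n] ∧ [2] → [m]` that is `f` on the first copy of `[n]` and `g` on the second one. -/
def twoCopies {n m : ℕ} (f g : PtMap n m) : PtMap (n * 2) m :=
  PtMap.ofFun fun c => if ((colex n 2).symm c).2 = 0 then f ((colex n 2).symm c).1.succ
    else g ((colex n 2).symm c).1.succ

/-- This realizes addition by pointed maps: `(1, 1)` supplies two copies of one vector, which can be
mapped independently. -/
theorem map_twoCopies {n m : ℕ} (f g : PtMap n m) (v : Fin n → ℤ) :
    map (twoCopies f g) (mul v ![1, 1]) = map f v + map g v := by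
  funext t
  simp only [map, Pi.add_apply]
  rw [← (colex n 2).sum_comp, Fintype.sum_prod_type, ← Finset.sum_add_distrib]
  refine Finset.sum_congr rfl fun i _ => ?_
  rw [Fin.sum_univ_two]
  simp [twoCopies, mul_colex]

theorem Representable.add {n : ℕ} {v w : Fin n → ℤ} (hv : Representable v)
    (hw : Representable w) : Representable (v + w) := by
  obtain ⟨k, f, hf⟩ := hv
  obtain ⟨l, g, hg⟩ := hw
  -- Addition needs one common power as source; padding the smaller exponent provides it.
  have main : ∀ {k : ℕ} {f g : PtMap (2 ^ k) n}, Represents v f → Represents w g →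
      Representable (v + w) := by
    intro k f g hf hg
    rw [← hf, ← hg, ← map_twoCopies]
    exact ((representable_signs k).mul representable_one_one).map _
  rcases le_total k l with h | h
  · obtain ⟨m, rfl⟩ := Nat.exists_eq_add_of_le h
    exact main (hf.extendAdd m) hg
  · obtain ⟨m, rfl⟩ := Nat.exists_eq_add_of_le h
    exact main hf (hg.extendAdd m)

theorem Representable.neg {n : ℕ} {v : Fin n → ℤ} (hv : Representable v) :
    Representable (-v) := by
  have h1 : Representable (fun _ : Fin 1 => (-1 : ℤ)) := by
    have h := (representable_signs 1).map (m := 1) (PtMap.ofFun (n := 2) ![0, 1])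
    rw [show signs 1 = ![1, -1] from DiscreteGammaRing.pow_one_two HZ HZ.diff] at h
    convert h using 1
    decide
  have h2 := (hv.mul h1).map (PtMap.cast (Nat.mul_one n))
  convert h2 using 1
  -- Moving the sign to the other factor reduces the claim to the unit law.
  have h3 : HZ.mul v (fun _ : Fin 1 => (-1 : ℤ)) = HZ.mul (-v) (eta 1 1) := by
    refine fun_ext fun i j => ?_
    rw [mul_colex, mul_colex, Subsingleton.elim j 0]
    simp [eta]
  rw [h3]
  exact (DiscreteGammaRing.map_cast_mul_one HZ (-v : Fin n → ℤ)).symm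

theorem representable {n : ℕ} (v : Fin n → ℤ) : Representable v := by
  let S : AddSubgroup (Fin n → ℤ) :=
    { carrier := {v | Representable v}
      add_mem' := fun hv hw => hv.add hw
      zero_mem' := by
        have h : Representable (eta n 0) := ⟨0, _, represents_eta n 0⟩
        rwa [show eta n 0 = 0 from HZ.eta_zero n] at h
      neg_mem' := fun hv => hv.neg }
  have hgen : ∀ t : Fin n, Pi.single t (1 : ℤ) ∈ S := by
    intro t
    have h : Representable (eta n t.succ) := ⟨0, _, represents_eta n t.succ⟩
    have he : (Pi.single t (1 : ℤ) : Fin n → ℤ) = eta n t.succ := by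
      funext j
      simp [eta, Pi.single_apply, eq_comm]
    rw [he]
    exact h
  have hv : v = ∑ t, v t • (Pi.single t (1 : ℤ) : Fin n → ℤ) := by
    funext j
    simp [Finset.sum_apply, Pi.single_apply]
  change v ∈ S
  rw [hv]
  exact S.sum_mem fun t _ => S.zsmul_mem (hgen t) _

end HZ

/-! ### The multiplicative map of a formal difference law -/

namespace IsFormalDifferenceLaw

variable {R : DiscreteGammaRing.{u}} {r : R.obj 2}

/-- Both `f` and its altered version factor through the two sides of `cancel` by the same map. The
position `l` is immaterial and is taken to be `1`. -/
theorem map_kill (hr : IsFormalDifferenceLaw R r) {k n : ℕ} (f : PtMap (2 ^ k) n)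
    (i j : Fin (2 ^ k)) (hij : i ≠ j) (hs : HZ.signs k i + HZ.signs k j = 0)
    (hf : f i.succ = f j.succ) : R.map (f.kill i j) (R.pow r k) = R.map f (R.pow r k) := by
  wlog hlt : i < j generalizing i j
  · rw [PtMap.kill_comm]
    exact this j i hij.symm (by rw [add_comm, hs]) hf.symm (by omega)
  have hlt' : i.val < j.val := hlt
  have hj := j.isLt
  obtain ⟨h, h1, h2⟩ := PtMap.exists_factor_s (2 ^ k) (i.val + 1) (j.val + 1) 1 (by omega)
    (by omega) (by omega) le_rfl (by omega) f i j rfl rfl hf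
  rw [← h2, R.map_comp, R.map_comp, R.map_comp, ← hr.cancel k (i.val + 1) (j.val + 1) 1
    (by omega) (by omega) (by omega) le_rfl (by omega) ((HZ.opposite_iff k i j).2 hs),
    ← R.map_comp, h1]

theorem map_eq_of_same_exponent (hr : IsFormalDifferenceLaw R r) {k n : ℕ}
    {f g : PtMap (2 ^ k) n} (h : HZ.map f (HZ.signs k) = HZ.map g (HZ.signs k)) :
    R.map f (R.pow r k) = R.map g (R.pow r k) := by
  have hex := exists_reduced (HZ.signs_eq_one_or k) (fun f : PtMap (2 ^ k) n => R.map f (R.pow r k))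
    hr.map_kill
  obtain ⟨f', hf, hf1, hf2⟩ := hex f
  obtain ⟨g', hg, hg1, hg2⟩ := hex g
  obtain ⟨e, he, rfl⟩ := hf.exists_perm (HZ.signs_eq_one_or k) hg (by rw [hf1, hg1, h])
  rw [← hf2, ← hg2]
  rw [R.map_comp, hr.special k e ((HZ.isSpecial_iff k e).2 he)]

theorem map_eq_of_represents (hr : IsFormalDifferenceLaw R r) {n k l : ℕ} {v : Fin n → ℤ}
    {f : PtMap (2 ^ k) n} {g : PtMap (2 ^ l) n} (hf : HZ.Represents v f)
    (hg : HZ.Represents v g) : R.map f (R.pow r k) = R.map g (R.pow r l) := by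
  wlog hkl : k ≤ l generalizing k l
  · exact (this hg hf (by omega)).symm
  obtain ⟨m, rfl⟩ := Nat.exists_eq_add_of_le hkl
  rw [← map_extendAdd hr.p_two f m]
  exact hr.map_eq_of_same_exponent ((hf.extendAdd m).trans hg.symm)

/-- The value at `v` of the multiplicative map: the image of a power of `r` under a map that
represents `v`. -/
noncomputable def value (r : R.obj 2) {n : ℕ} (v : Fin n → ℤ) : R.obj n :=
  R.map (HZ.representable v).choose_spec.choose (R.pow r (HZ.representable v).choose)

theorem value_eq (hr : IsFormalDifferenceLaw R r) {n k : ℕ} {v : Fin n → ℤ}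
    {f : PtMap (2 ^ k) n} (hf : HZ.Represents v f) : value r v = R.map f (R.pow r k) :=
  hr.map_eq_of_represents (HZ.representable v).choose_spec.choose_spec hf

/-- Generators are represented with exponent `0`, where `r^0` is the unit. -/
theorem value_eta (hr : IsFormalDifferenceLaw R r) (n : ℕ) (a : Fin (n + 1)) :
    value r (HZ.eta n a) = R.eta n a :=
  (hr.value_eq (HZ.represents_eta n a)).trans
    (R.eta_map (PtMap.ofFun (n := 1) fun _ => a) 1)

/-- The multiplicative map `HZ → R` determined by a formal difference law. -/
noncomputable def multMap (hr : IsFormalDifferenceLaw R r) : MultMap HZ R where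
  app n v := value r v
  app_zero n := by
    rw [← R.eta_zero, ← hr.value_eta, ← HZ.eta_zero]
    rfl
  naturality {n m} g v := by
    obtain ⟨k, f, hf⟩ := HZ.representable v
    rw [hr.value_eq hf, ← R.map_comp]
    exact hr.value_eq (hf.map g)
  app_eta n a := hr.value_eta n a
  app_mul {n m} v w := by
    obtain ⟨k, f, hf⟩ := HZ.representable v
    obtain ⟨l, g, hg⟩ := HZ.representable w
    rw [hr.value_eq hf, hr.value_eq hg, ← map_mulRep]
    exact hr.value_eq (hf.mul hg)

theorem multMap_app_pow (hr : IsFormalDifferenceLaw R r) (k : ℕ) :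
    hr.multMap.app (2 ^ k) (HZ.pow HZ.diff k) = R.pow r k :=
  (hr.value_eq (f := PtMap.id (2 ^ k)) (HZ.map_id (HZ.signs k))).trans (R.map_id _)

end IsFormalDifferenceLaw

/-- A multiplicative map out of `HZ` is determined by its values on the powers of `(1, -1)`. -/
theorem MultMap.ext_of_pow {R : DiscreteGammaRing.{u}} {φ ψ : MultMap HZ R}
    (h : ∀ k : ℕ, φ.app (2 ^ k) (HZ.pow HZ.diff k) = ψ.app (2 ^ k) (HZ.pow HZ.diff k)) :
    φ = ψ := by
  ext n v
  obtain ⟨k, f, hf⟩ := HZ.representable v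
  rw [← hf]
  refine (φ.naturality f (HZ.pow HZ.diff k)).trans ?_
  rw [h]
  exact (ψ.naturality f (HZ.pow HZ.diff k)).symm

/-- Formal difference laws in `R` correspond to multiplicative maps `HZ → R`. -/
noncomputable def formalDifferenceLawEquiv (R : DiscreteGammaRing.{u}) :
    FormalDifferenceLaw R ≃ MultMap HZ R where
  toFun r := r.2.multMap
  invFun φ := ⟨φ.app 2 HZ.diff, HZ.diff_isFormalDifferenceLaw.app φ⟩
  left_inv r := by
    apply Subtype.ext
    -- The exponent `1` recovers `r` itself.
    have h := r.2.multMap_app_pow 1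
    rwa [HZ.pow_one_two, R.pow_one_two] at h
  right_inv φ := MultMap.ext_of_pow fun k => by
    rw [IsFormalDifferenceLaw.multMap_app_pow, φ.app_pow]

theorem theorem3p4 :
    -- every formal difference law determines a multiplicative map from `HZ`
    (∀ (R : DiscreteGammaRing.{u}) (r : R.obj 2), IsFormalDifferenceLaw R r →
      ∃! φ : MultMap HZ R, ∀ n : ℕ, φ.app (2 ^ n) (HZ.pow HZ.diff n) = R.pow r n) ∧
    -- this is a natural bijection, with inverse `φ ↦ φ(1, -1)`
    (∃ e : ∀ R : DiscreteGammaRing.{u}, FormalDifferenceLaw R ≃ MultMap HZ R,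
      (∀ (R : DiscreteGammaRing.{u}) (r : FormalDifferenceLaw R) (n : ℕ),
        (e R r).app (2 ^ n) (HZ.pow HZ.diff n) = R.pow r.val n) ∧
      (∀ (R : DiscreteGammaRing.{u}) (φ : MultMap HZ R),
        ((e R).symm φ).val = φ.app 2 HZ.diff) ∧
      (∀ (R R' : DiscreteGammaRing.{u}) (ψ : MultMap R R') (φ : MultMap HZ R),
        ((e R').symm (ψ.comp φ)).val = ψ.app 2 ((e R).symm φ).val)) := by
  refine ⟨fun R r hr => ⟨hr.multMap, hr.multMap_app_pow, fun φ hφ => ?_⟩,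
    formalDifferenceLawEquiv, fun R r n => r.2.multMap_app_pow n, fun _ _ => rfl,
    fun _ _ _ _ => rfl⟩
  exact MultMap.ext_of_pow fun k => (hφ k).trans (hr.multMap_app_pow k).symm
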